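/- Manifolds are finite-dimensional, smooth, Hausdorff and second countable. Let $n\ge 1$, $\zeta=\exp(2\pi i/n)$ and let $C_n=\{z\in\mathbb C^\times: z^n=1\}$ be the group of $n$-th roots of unity, regarded as a zero-dimensional Lie group. A dynamical system $(A,C_n,\alpha)$ is a unital locally convex complex algebra $A$ with a homomorphism $\alpha:C_n\to\mathrm{Aut}(A)$ that induces a continuous action of $C_n$ on $A$. It is called a trivial noncommutative principal $C_n$-bundle if for each $k=0,\dots,n-1$ the isotypic component $A_k=\{a\in A:\alpha(\zeta)a=\zeta^k a\}$ contains an invertible element $a_k$ with $a_k^n=1_A$. For a manifold $P$, let $C^\infty(P)$ be the algebra of smooth complex-valued functions on $P$ with the smooth compact-open topology, and for $p\in P$ let $\delta_p:C^\infty(P)\to\mathbb C$ be the evaluation at $p$. A principal $C_n$-bundle $(P,M,C_n,q,\sigma)$ (smooth projection $q:P\to M$ onto a manifold $M$, free smooth right action $\sigma:P\times C_n\to P$ whose orbits are the fibres of $q$, locally trivial) is trivial if there is a $C_n$-equivariant diffeomorphism $P\to M\times C_n$ over $M$. Theorem. Let $P$ be a manifold. (a) Suppose that $(C^\infty(P),C_n,\alpha)$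 is a trivial noncommutative principal $C_n$-bundle. Then there is a map $\sigma:P\times C_n\to P$ with $\delta_{\sigma(p,z)}=\delta_p\circ\alpha(z)$ for all $p\in P$, $z\in C_n$. The orbit space $P/C_n$ carries a manifold structure for which $(P,P/C_n,C_n,\mathrm{pr},\sigma)$, with $\mathrm{pr}$ the orbit map, is a principal $C_n$-bundle, and (for every such manifold structure) this principal bundle is trivial. (b) Conversely, if $(P,M,C_n,q,\sigma)$ is a trivial principal $C_n$-bundle, then $(\alpha(z)f)(p):=f(\sigma(p,z))$ defines a dynamical system $(C^\infty(P),C_n,\alpha)$, and it is a trivial noncommutative principal $C_n$-bundle. -/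

import Mathlib

open scoped Manifold ContDiff Topology

noncomputable section

/-! ### Dynamical systems on unital locally convex algebras -/

/-- A unital (associative, complex) algebra with a topology is a locally convex algebra if it is a
locally convex space with jointly continuous multiplication. -/
class LocallyConvexAlgebra (A : Type*) [Ring A] [Algebra ℂ A] [TopologicalSpace A] : Prop
    extends IsTopologicalRing A, ContinuousSMul ℂ A, LocallyConvexSpace ℝ A

/-- A dynamical system `(A, G, α)`: a homomorphism `α` from the topological group `G` to the
automorphisms of the unital locally convex algebra `A` that induces a continuous action
`G × A → A`. (So each `α g` is a homeomorphism of `A`, with inverse `α g⁻¹`.) -/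
structure DynamicalSystem (G : Type*) [Group G] [TopologicalSpace G] [IsTopologicalGroup G]
    (A : Type*) [Ring A] [Algebra ℂ A] [TopologicalSpace A] [LocallyConvexAlgebra A] where
  /-- the homomorphism into the automorphism group -/
  α : G →* (A ≃ₐ[ℂ] A)
  continuous_action : Continuous fun x : G × A => α x.1 x.2

/-! ### The cyclic group of `n`-th roots of unity -/

/-- `C_n`, the group of complex `n`-th roots of unity (with the subspace topology). -/
abbrev CyclicRoots (n : ℕ) : Type := rootsOfUnity n ℂ

/-- The generator `ζ = exp(2πi/n)` of `C_n`. -/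
def zetaGen (n : ℕ) [NeZero n] : CyclicRoots n :=
  (Complex.isPrimitiveRoot_exp n (NeZero.ne n)).toRootsOfUnity

theorem zetaGen_coe (n : ℕ) [NeZero n] :
    (((zetaGen n : CyclicRoots n) : ℂˣ) : ℂ) = Complex.exp (2 * Real.pi * Complex.I / n) := rfl

/-- `C_n` as a zero-dimensional manifold. -/
instance (n : ℕ) [NeZero n] : ChartedSpace (EuclideanSpace ℝ (Fin 0)) (CyclicRoots n) :=
  ChartedSpace.ofDiscreteTopology

/-- `C_n` is a (zero-dimensional) Lie group. -/
instance (n : ℕ) [NeZero n] : LieGroup 𝓘(ℝ, EuclideanSpace ℝ (Fin 0)) ∞ (CyclicRoots n) :=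
  { IsManifold.of_discreteTopology (𝕜 := ℝ) (M := CyclicRoots n)
      (E := EuclideanSpace ℝ (Fin 0)) ∞ with
    contMDiff_mul := contMDiff_of_discreteTopology
    contMDiff_inv := contMDiff_of_discreteTopology }

namespace DynamicalSystem

variable {n : ℕ} [NeZero n] {A : Type*} [Ring A] [Algebra ℂ A] [TopologicalSpace A]
  [LocallyConvexAlgebra A]

/-- The isotypic component `A_k = {a : α(ζ) a = ζ ^ k • a}`. -/
def isotypic (S : DynamicalSystem (CyclicRoots n) A) (k : ℕ) : Set A :=
  {a | S.α (zetaGen n) a = (Complex.exp (2 * Real.pi * Complex.I / n)) ^ k • a}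

/-- `(A, C_n, α)` is a trivial noncommutative principal `C_n`-bundle: each isotypic component
`A_k`, `k = 0, …, n - 1`, contains an invertible element `a` with `a ^ n = 1`. -/
def IsTrivialNCPrincipalBundle (S : DynamicalSystem (CyclicRoots n) A) : Prop :=
  ∀ k < n, ∃ a ∈ S.isotypic k, IsUnit a ∧ a ^ n = 1

end DynamicalSystem

/-! ### The locally convex algebra of smooth functions -/

section SmoothFunctions

variable (E : Type*) [NormedAddCommGroup E] [NormedSpace ℝ E]
  (P : Type*) [TopologicalSpace P] [ChartedSpace E P]

/-- The smooth complex-valued functions, as a subalgebra of all functions `P → ℂ`. -/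
def smoothSubalgebra : Subalgebra ℂ (P → ℂ) where
  carrier := {f | ContMDiff 𝓘(ℝ, E) 𝓘(ℝ, ℂ) ∞ f}
  mul_mem' {f g} hf hg := by
    have h : ContMDiff 𝓘(ℝ, ℂ × ℂ) 𝓘(ℝ, ℂ) ∞ (fun z : ℂ × ℂ => z.1 * z.2) :=
      contDiff_mul.contMDiff
    exact h.comp (hf.prodMk_space hg)
  add_mem' {f g} hf hg := ContMDiff.add hf hg
  algebraMap_mem' c := contMDiff_const

/-- `C^∞(P)`, the algebra of smooth complex-valued functions on `P`. -/
def SmoothFun : Type _ := smoothSubalgebra E P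

namespace SmoothFun

instance : CommRing (SmoothFun E P) := inferInstanceAs (CommRing (smoothSubalgebra E P))

instance : Algebra ℂ (SmoothFun E P) := inferInstanceAs (Algebra ℂ (smoothSubalgebra E P))

instance : FunLike (SmoothFun E P) P ℂ where
  coe f := f.1
  coe_injective := Subtype.val_injective

/-- The point evaluation `δ_p`. -/
def eval (p : P) : SmoothFun E P →ₐ[ℂ] ℂ where
  toFun f := f p
  map_one' := rfl
  map_mul' _ _ := rfl
  map_zero' := rfl
  map_add' _ _ := rfl
  commutes' _ := rfl

variable {E P}

theorem contMDiff (f : SmoothFun E P) : ContMDiff 𝓘(ℝ, E) 𝓘(ℝ, ℂ) ∞ (f : P → ℂ) := f.2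

/-- The higher derivative `X₁ (X₂ (⋯ (X_m f)))` along a list of smooth vector fields on `P`, where
a (complex) smooth vector field is a derivation of the algebra `C^∞(P)`. -/
def iterDeriv (X : List (Derivation ℂ (SmoothFun E P) (SmoothFun E P))) :
    SmoothFun E P →ₗ[ℂ] SmoothFun E P :=
  X.foldr (fun D L => (D : SmoothFun E P →ₗ[ℂ] SmoothFun E P) ∘ₗ L) LinearMap.id

/-- The inclusion of `C^∞(P)` in the continuous functions. -/
def toContinuousMap : SmoothFun E P →ₗ[ℂ] C(P, ℂ) where
  toFun f := ⟨f, f.contMDiff.continuous⟩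
  map_add' _ _ := rfl
  map_smul' _ _ := rfl

variable (E P)

/-- The smooth compact-open topology on `C^∞(P)`: uniform convergence on compact sets of the
functions and of all their higher derivatives along smooth vector fields. -/
instance : TopologicalSpace (SmoothFun E P) :=
  ⨅ X : List (Derivation ℂ (SmoothFun E P) (SmoothFun E P)),
    TopologicalSpace.induced (toContinuousMap ∘ₗ iterDeriv X) ContinuousMap.compactOpen

theorem continuous_toContinuousMap_iterDeriv
    (X : List (Derivation ℂ (SmoothFun E P) (SmoothFun E P))) :
    Continuous fun f : SmoothFun E P => toContinuousMap (iterDeriv X f) :=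
  continuous_iInf_dom (i := X) continuous_induced_dom

theorem continuous_iff {Z : Type*} [TopologicalSpace Z] (u : Z → SmoothFun E P) :
    Continuous u ↔ ∀ X : List (Derivation ℂ (SmoothFun E P) (SmoothFun E P)),
      Continuous fun z => toContinuousMap (iterDeriv X (u z)) := by
  refine ⟨fun h X => (continuous_toContinuousMap_iterDeriv E P X).comp h, fun h => ?_⟩
  exact continuous_iInf_rng.2 fun X => continuous_induced_rng.2 (h X)

theorem continuous_mul_aux [FiniteDimensional ℝ E]
    (X : List (Derivation ℂ (SmoothFun E P) (SmoothFun E P))) :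
    ∀ Y Y' : List (Derivation ℂ (SmoothFun E P) (SmoothFun E P)),
      Continuous fun x : SmoothFun E P × SmoothFun E P =>
        toContinuousMap (iterDeriv X (iterDeriv Y x.1 * iterDeriv Y' x.2)) := by
  have : LocallyCompactSpace P := Manifold.locallyCompact_of_finiteDimensional 𝓘(ℝ, E)
  induction X using List.reverseRecOn with
  | nil =>
    intro Y Y'
    exact ((continuous_toContinuousMap_iterDeriv E P Y).comp continuous_fst).mul
      ((continuous_toContinuousMap_iterDeriv E P Y').comp continuous_snd)
  | append_singleton X D ih =>
    intro Y Y'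
    have key : ∀ f : SmoothFun E P, iterDeriv (X ++ [D]) f = iterDeriv X (D f) := by
      intro f
      have : ∀ X : List (Derivation ℂ (SmoothFun E P) (SmoothFun E P)),
          iterDeriv (X ++ [D]) f = iterDeriv X (D f) := by
        intro X
        induction X with
        | nil => rfl
        | cons D' X ih' => exact congrArg D' ih'
      exact this X
    have h := (ih Y (D :: Y')).add (ih (D :: Y) Y')
    refine h.congr fun x => ?_
    rw [key, Derivation.leibniz, map_add, map_add]
    rw [smul_eq_mul, smul_eq_mul, mul_comm (iterDeriv Y' x.2)]
    rfl

/-- For a finite-dimensional manifold `P`, `C^∞(P)` is a unital locally convex algebra. -/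
instance [FiniteDimensional ℝ E] : LocallyConvexAlgebra (SmoothFun E P) :=
  have h1 : IsTopologicalAddGroup (SmoothFun E P) :=
    topologicalAddGroup_iInf fun _ => topologicalAddGroup_induced _
  have h2 : ContinuousMul (SmoothFun E P) :=
    ⟨(continuous_iff E P _).2 fun X => continuous_mul_aux E P X [] []⟩
  have h3 : ContinuousSMul ℂ (SmoothFun E P) :=
    continuousSMul_iInf fun _ => continuousSMul_induced _
  have h4 : LocallyConvexSpace ℝ (SmoothFun E P) :=
    LocallyConvexSpace.iInf fun X => LocallyConvexSpace.induced
      ((toContinuousMap ∘ₗ iterDeriv X).restrictScalars ℝ)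
  { toIsTopologicalSemiring := { toContinuousAdd := h1.toContinuousAdd, toContinuousMul := h2 }
    toContinuousNeg := h1.toContinuousNeg
    toContinuousSMul := h3
    toLocallyConvexSpace := h4 }

end SmoothFun

end SmoothFunctions

/-! ### Principal bundles -/

section PrincipalBundles

variable (EP EM EG : Type*) [NormedAddCommGroup EP] [NormedSpace ℝ EP]
  [NormedAddCommGroup EM] [NormedSpace ℝ EM] [NormedAddCommGroup EG] [NormedSpace ℝ EG]
  {P M G : Type*} [TopologicalSpace P] [ChartedSpace EP P] [TopologicalSpace M]
  [ChartedSpace EM M] [Group G] [TopologicalSpace G] [ChartedSpace EG G]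
  [LieGroup 𝓘(ℝ, EG) ∞ G]

/-- `σ` is a smooth right action of the Lie group `G` on the manifold `P`. -/
structure IsSmoothRightAction (σ : P × G → P) : Prop where
  act_one : ∀ p, σ (p, 1) = p
  act_mul : ∀ p g h, σ (σ (p, g), h) = σ (p, g * h)
  smooth : ContMDiff (𝓘(ℝ, EP).prod 𝓘(ℝ, EG)) 𝓘(ℝ, EP) ∞ σ

/-- `(P, M, G, q, σ)` is a smooth principal bundle: `σ` is a free smooth right action of `G` on
`P`, the smooth surjection `q : P → M` has the orbits as fibres, and `P` is locally trivial, i.e.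
each point of `M` has an open neighbourhood `U` with an equivariant diffeomorphism
`q⁻¹(U) ≅ U × G` over `U`. -/
structure IsPrincipalBundle (q : P → M) (σ : P × G → P) : Prop
    extends IsSmoothRightAction EP EG σ where
  free : ∀ p g, σ (p, g) = p → g = 1
  smooth_proj : ContMDiff 𝓘(ℝ, EP) 𝓘(ℝ, EM) ∞ q
  surjective_proj : Function.Surjective q
  fibre_eq_orbit : ∀ p p', q p = q p' ↔ ∃ g, σ (p, g) = p'
  locally_trivial : ∀ x : M, ∃ (U : TopologicalSpace.Opens M) (V : TopologicalSpace.Opens P),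
    x ∈ U ∧ (V : Set P) = q ⁻¹' U ∧
    ∃ ψ : Diffeomorph 𝓘(ℝ, EP) (𝓘(ℝ, EM).prod 𝓘(ℝ, EG)) V (U × G) ∞,
      (∀ v : V, ((ψ v).1 : M) = q v) ∧
      ∀ (v w : V) (g : G), σ (v, g) = w → ψ w = ((ψ v).1, (ψ v).2 * g)

/-- The principal bundle `(P, M, G, q, σ)` is trivial: it is equivalent, over `M`, to the product
bundle `M × G` with `G` acting by right multiplication on the second factor. -/
structure IsTrivialPrincipalBundle (q : P → M) (σ : P × G → P) : Prop
    extends IsPrincipalBundle EP EM EG q σ where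
  equivalence : ∃ φ : Diffeomorph 𝓘(ℝ, EP) (𝓘(ℝ, EM).prod 𝓘(ℝ, EG)) P (M × G) ∞,
    (∀ p, (φ p).1 = q p) ∧ ∀ p g, φ (σ (p, g)) = ((φ p).1, (φ p).2 * g)

end PrincipalBundles

/-- The orbit space `P/G` (with the quotient topology) of a right action `σ`. -/
abbrev OrbitSpace {P G : Type*} (σ : P × G → P) : Type _ :=
  Quot fun p p' : P => ∃ g, σ (p, g) = p'

/-- The canonical orbit map `pr : P → P/G`. -/
def orbitMap {P G : Type*} (σ : P × G → P) : P → OrbitSpace σ := Quot.mk _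

end

/-! Part (a) rests on the fact that every character of `C^∞(P)` is evaluation at a unique point
(`exists_eval_eq`, `eval_injective`). Hence `δ_p ∘ α(z)` is some `δ_{σ(p,z)}`, which defines `σ`; it
is smooth because its pullbacks `α(z) f` of smooth functions are smooth
(`contMDiff_of_forall_comp`).

Only the component of index 1 mod `n` is needed: its element with `n`-th power 1 is a continuous map
`a : P → C_n` with `a(p·z) = a(p) z`. The map `p ↦ p·a(p)⁻¹` is constant on orbits and descends to a
section `s` of `pr` with image the open set `a⁻¹(1)`. So `s` is an open embedding of `P/C_n` in `P`
(`isOpenEmbedding_orbitSection`); it transports the manifold structure, and `(pr, a)` is a global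
trivialisation. For any other admissible structure, `s` is smooth by local triviality
(`contMDiff_section`), and `(pr, a)` again trivialises.

For (b), the powers of the `C_n`-component of a trivialisation provide the required units.
Continuity of the action holds because automorphisms permute the derivations defining the topology
(`iterDeriv_algEquiv`). -/

noncomputable section

/-! ### Characters of the algebra of smooth functions -/

section Characters

variable {E : Type*} [NormedAddCommGroup E] [NormedSpace ℝ E]
  {P : Type*} [TopologicalSpace P] [ChartedSpace E P]

namespace SmoothFun

/-- A smooth complex-valued function as an element of `C^∞(P)`. -/
def mk (f : P → ℂ) (hf : ContMDiff 𝓘(ℝ, E) 𝓘(ℝ, ℂ) ∞ f) : SmoothFun E P := ⟨f, hf⟩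

@[simp] theorem mk_apply (f : P → ℂ) (hf : ContMDiff 𝓘(ℝ, E) 𝓘(ℝ, ℂ) ∞ f) (p : P) :
    mk f hf p = f p := rfl

@[simp] theorem eval_apply (p : P) (f : SmoothFun E P) : eval E P p f = f p := rfl

theorem ext {f g : SmoothFun E P} (h : ∀ p, f p = g p) : f = g := DFunLike.ext f g h

/-- The pointwise complex conjugate of a smooth function. -/
def conj (f : SmoothFun E P) : SmoothFun E P :=
  mk (fun p => starRingEnd ℂ (f p)) (Complex.conjCLE.contDiff.contMDiff.comp f.contMDiff)

/-- A smooth real-valued function as an element of `C^∞(P)`. -/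
def ofReal (f : P → ℝ) (hf : ContMDiff 𝓘(ℝ, E) 𝓘(ℝ, ℝ) ∞ f) : SmoothFun E P :=
  mk (fun p => (f p : ℂ)) (Complex.ofRealCLM.contDiff.contMDiff.comp hf)

@[simp] theorem ofReal_apply (f : P → ℝ) (hf : ContMDiff 𝓘(ℝ, E) 𝓘(ℝ, ℝ) ∞ f) (p : P) :
    ofReal f hf p = (f p : ℂ) := rfl

theorem isUnit_of_forall_ne_zero (f : SmoothFun E P) (hf : ∀ p, f p ≠ 0) : IsUnit f := by
  have h : ContMDiff 𝓘(ℝ, E) 𝓘(ℝ, ℂ) ∞ fun p => (f p)⁻¹ := fun p =>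
    ((contDiffAt_inv ℝ (hf p)).contMDiffAt).comp p (f.contMDiff p)
  exact IsUnit.of_mul_eq_one (mk _ h) (ext fun p => mul_inv_cancel₀ (hf p))

theorem exists_zero_of_character (χ : SmoothFun E P →ₐ[ℂ] ℂ) (f : SmoothFun E P) (hf : χ f = 0) :
    ∃ p, f p = 0 := by
  by_contra! h
  exact ((isUnit_of_forall_ne_zero f h).map χ).ne_zero hf

/-- The sum of the `|f - χ f|²` lies in the kernel of `χ`, as each term has a factor there, so it
vanishes somewhere. Neither continuity of `χ` nor compatibility with conjugation is used. -/
theorem exists_forall_mem_finset (χ : SmoothFun E P →ₐ[ℂ] ℂ) (t : Finset (SmoothFun E P)) :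
    ∃ p, ∀ f ∈ t, f p = χ f := by
  let d : SmoothFun E P → SmoothFun E P := fun f => f - algebraMap ℂ _ (χ f)
  have hd : ∀ f, χ (d f) = 0 := fun f => by simp [d]
  have hd' : ∀ f p, d f p = f p - χ f := fun _ _ => rfl
  obtain ⟨p, hp⟩ := exists_zero_of_character χ (∑ f ∈ t, d f * conj (d f)) (by simp [hd])
  refine ⟨p, fun f hf => ?_⟩
  have h1 : eval E P p (∑ f ∈ t, d f * conj (d f)) = ((∑ f ∈ t, Complex.normSq (d f p) : ℝ) : ℂ) := by
    rw [map_sum, Complex.ofReal_sum]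
    exact Finset.sum_congr rfl fun g _ => by
      rw [map_mul, Complex.normSq_eq_conj_mul_self, mul_comm]; rfl
  rw [eval_apply, hp, eq_comm, Complex.ofReal_eq_zero,
    Finset.sum_eq_zero_iff_of_nonneg fun _ _ => Complex.normSq_nonneg _] at h1
  have := Complex.normSq_eq_zero.1 (h1 f hf)
  rwa [hd', sub_eq_zero] at this

variable [FiniteDimensional ℝ E] [IsManifold 𝓘(ℝ, E) ∞ P] [T2Space P]

/-- A smooth function dominating the index of a compact exhaustion has each fibre inside one member
of it. -/
theorem exists_proper [SecondCountableTopology P] :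
    ∃ f : P → ℝ, ContMDiff 𝓘(ℝ, E) 𝓘(ℝ, ℝ) ∞ f ∧ ∀ c, IsCompact (f ⁻¹' {c}) := by
  have : LocallyCompactSpace P := Manifold.locallyCompact_of_finiteDimensional 𝓘(ℝ, E)
  let K : CompactExhaustion P := default
  obtain ⟨f, hf⟩ := exists_contMDiffMap_forall_mem_convex_of_local_const 𝓘(ℝ, E) (n := ⊤)
    (t := fun x => Set.Ici (K.find x : ℝ)) (fun x => convex_Ici _) (fun x => by
      -- The index may jump near `x`, but by at most one, since `x` is interior to the next member
      -- of the exhaustion.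
      refine ⟨(K.find x + 1 : ℕ), ?_⟩
      have h : interior (K (K.find x + 1)) ∈ 𝓝 x :=
        isOpen_interior.mem_nhds (K.subset_interior_succ _ (K.mem_find x))
      filter_upwards [h] with y hy
      exact (Nat.cast_le.2 (K.mem_iff_find_le.1 (interior_subset hy)) : (_ : ℝ) ≤ _))
  refine ⟨f, f.contMDiff, fun c => ?_⟩
  refine (K.isCompact ⌈c⌉₊).of_isClosed_subset (isClosed_singleton.preimage f.contMDiff.continuous) ?_
  rintro x rfl
  exact K.mem_iff_find_le.2 (Nat.cast_le.1 ((hf x).trans (Nat.le_ceil _)))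

/-- Every character of `C^∞(P)` is a point evaluation. -/
theorem exists_eval_eq [SecondCountableTopology P] (χ : SmoothFun E P →ₐ[ℂ] ℂ) :
    ∃ p, eval E P p = χ := by
  obtain ⟨f, hf, hc⟩ := exists_proper (E := E) (P := P)
  let F : SmoothFun E P := ofReal f hf
  have hK : IsCompact {p | F p = χ F} := by
    refine (hc (χ F).re).of_isClosed_subset (isClosed_eq F.contMDiff.continuous continuous_const) ?_
    intro p hp
    have hp : (f p : ℂ) = χ F := hp
    simp [← hp]
  -- Finite intersection property in the compact set where `F = χ F`; inserting `F` into each finite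
  -- family keeps the common point there.
  obtain ⟨p, -, hp⟩ := hK.inter_iInter_nonempty (fun g : SmoothFun E P => {p | g p = χ g})
    (fun g => isClosed_eq g.contMDiff.continuous continuous_const) (fun t => by
      classical
      obtain ⟨p, hp⟩ := exists_forall_mem_finset χ (insert F t)
      exact ⟨p, hp F (Finset.mem_insert_self _ _),
        Set.mem_iInter₂.2 fun g hg => hp g (Finset.mem_insert_of_mem hg)⟩)
  exact ⟨p, AlgHom.ext fun g => Set.mem_iInter.1 hp g⟩

theorem exists_eq_one_support_subset {p : P} {U : Set P} (hU : U ∈ 𝓝 p) :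
    ∃ f : SmoothFun E P, f p = 1 ∧ ∀ x, f x ≠ 0 → x ∈ U := by
  obtain ⟨b, hb, -⟩ := (SmoothBumpFunction.nhds_basis_support (I := 𝓘(ℝ, E)) hU).mem_iff.1 hU
  exact ⟨ofReal b b.contMDiff, by simp, fun x hx =>
    hb (subset_tsupport _ fun h => hx (by simp [h]))⟩

theorem eval_injective : Function.Injective (eval E P) := by
  intro p p' h
  by_contra hne
  obtain ⟨f, hf, hf'⟩ := exists_eq_one_support_subset (E := E)
    (isOpen_compl_singleton.mem_nhds hne : ({p'}ᶜ : Set P) ∈ 𝓝 p)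
  have : f p = f p' := DFunLike.congr_fun h f
  exact hf' p' (by rw [← this, hf]; exact one_ne_zero) rfl

/-- A map into a manifold is smooth if it pulls smooth functions back to smooth functions. -/
theorem contMDiff_of_forall_comp {E₁ : Type*} [NormedAddCommGroup E₁] [NormedSpace ℝ E₁]
    {Q : Type*} [TopologicalSpace Q] [ChartedSpace E₁ Q] (τ : Q → P)
    (h : ∀ f : SmoothFun E P, ContMDiff 𝓘(ℝ, E₁) 𝓘(ℝ, ℂ) ∞ fun x => f (τ x)) :
    ContMDiff 𝓘(ℝ, E₁) 𝓘(ℝ, E) ∞ τ := by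
  have hcont : Continuous τ := continuous_iff_continuousAt.2 fun x U hU => by
    obtain ⟨f, hf, hf'⟩ := exists_eq_one_support_subset (E := E) hU
    have h0 : f (τ x) ≠ 0 := by simp [hf]
    have := (h f).continuous.continuousAt.eventually_ne h0
    exact Filter.mem_map.2 (this.mono fun y hy => hf' _ hy)
  -- The hypothesis extends from complex-valued to `E`-valued test functions by taking coordinates.
  have hE : ∀ g : P → E, ContMDiff 𝓘(ℝ, E) 𝓘(ℝ, E) ∞ g →
      ContMDiff 𝓘(ℝ, E₁) 𝓘(ℝ, E) ∞ fun x => g (τ x) := by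
    intro g hg
    let L := ContinuousLinearEquiv.ofFinrankEq (𝕜 := ℝ) (E := E)
      (F := Fin (Module.finrank ℝ E) → ℝ) (by simp)
    have hL : ContMDiff 𝓘(ℝ, E₁) 𝓘(ℝ, Fin (Module.finrank ℝ E) → ℝ) ∞ fun x => L (g (τ x)) := by
      refine contMDiff_pi_space.2 fun i => ?_
      have hi : ContMDiff 𝓘(ℝ, E) 𝓘(ℝ, ℝ) ∞ fun p => L (g p) i :=
        contMDiff_pi_space.1 (L.contDiff.contMDiff.comp hg) i
      exact Complex.reCLM.contDiff.contMDiff.comp (h (ofReal _ hi))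
    simpa [Function.comp_def] using L.symm.contDiff.contMDiff.comp hL
  intro x
  refine contMDiffAt_iff_target.2 ⟨hcont.continuousAt, ?_⟩
  obtain ⟨b⟩ : Nonempty (SmoothBumpFunction 𝓘(ℝ, E) (τ x)) := inferInstance
  -- The chart cut off by a bump function is globally smooth and agrees with the chart near `τ x`.
  have hg : ContMDiff 𝓘(ℝ, E) 𝓘(ℝ, E) ∞ fun p => b p • extChartAt 𝓘(ℝ, E) (τ x) p :=
    b.contMDiff_smul contMDiffOn_extChartAt
  refine (hE _ hg x).congr_of_eventuallyEq ?_
  filter_upwards [hcont.continuousAt.eventually b.eventuallyEq_one] with y hy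
  simp [hy]

end SmoothFun

end Characters

/-! ### Maps from and to discrete manifolds -/

section Discrete

variable {E₁ E₂ E₃ : Type*} [NormedAddCommGroup E₁] [NormedSpace ℝ E₁]
  [NormedAddCommGroup E₂] [NormedSpace ℝ E₂] [NormedAddCommGroup E₃] [NormedSpace ℝ E₃]
  {Q G R : Type*} [TopologicalSpace Q] [ChartedSpace E₁ Q] [TopologicalSpace G]
  [ChartedSpace E₂ G] [TopologicalSpace R] [ChartedSpace E₃ R] [DiscreteTopology G]

theorem Continuous.contMDiff_of_discrete {a : Q → G} (ha : Continuous a) :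
    ContMDiff 𝓘(ℝ, E₁) 𝓘(ℝ, E₂) ∞ a := fun x =>
  (contMDiffAt_const (c := a x)).congr_of_eventuallyEq
    (ha.continuousAt.eventually (mem_nhds_discrete.2 rfl : {a x} ∈ 𝓝 (a x)))

theorem contMDiff_prod_discrete {f : Q × G → R}
    (hf : ∀ g, ContMDiff 𝓘(ℝ, E₁) 𝓘(ℝ, E₃) ∞ fun x => f (x, g)) :
    ContMDiff (𝓘(ℝ, E₁).prod 𝓘(ℝ, E₂)) 𝓘(ℝ, E₃) ∞ f := by
  rintro ⟨x, g⟩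
  have h : ContMDiffAt (𝓘(ℝ, E₁).prod 𝓘(ℝ, E₂)) 𝓘(ℝ, E₃) ∞ (fun y : Q × G => f (y.1, g)) (x, g) :=
    ContMDiffAt.comp (g := fun y => f (y, g)) (f := Prod.fst) (x, g) (hf g x) contMDiffAt_fst
  refine h.congr_of_eventuallyEq ?_
  have : ∀ᶠ y : Q × G in 𝓝 (x, g), y.2 = g :=
    (continuous_snd.tendsto (x, g)).eventually (mem_nhds_discrete.2 rfl : {g} ∈ 𝓝 g)
  filter_upwards [this] with y hy
  rw [← hy]

end Discrete

/-! ### The manifold structure induced by an open embedding -/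

section OpenEmbedding

variable {E : Type*} [NormedAddCommGroup E]
  {P : Type*} [TopologicalSpace P] [ChartedSpace E P]
  {X : Type*} [TopologicalSpace X] {s : X → P}

namespace Topology.IsOpenEmbedding

/-- The chart around `x` obtained by pulling back the chart of `P` around `s x`. -/
def pullbackChart (hs : IsOpenEmbedding s) (x : X) : OpenPartialHomeomorph X E :=
  haveI : Nonempty X := ⟨x⟩
  (hs.toOpenPartialHomeomorph s).trans (chartAt E (s x))

theorem pullbackChart_source (hs : IsOpenEmbedding s) (x : X) :
    (hs.pullbackChart (E := E) x).source = s ⁻¹' (chartAt E (s x)).source := by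
  simp [pullbackChart]

theorem pullbackChart_apply (hs : IsOpenEmbedding s) (x y : X) :
    hs.pullbackChart (E := E) x y = chartAt E (s x) (s y) := rfl

theorem apply_pullbackChart_symm (hs : IsOpenEmbedding s) (x : X) {v : E}
    (hv : v ∈ (hs.pullbackChart (E := E) x).target) :
    s ((hs.pullbackChart (E := E) x).symm v) = (chartAt E (s x)).symm v := by
  have : Nonempty X := ⟨x⟩
  have h1 := (hs.pullbackChart (E := E) x).map_target hv
  rw [pullbackChart_source] at h1
  have h2 := (hs.pullbackChart (E := E) x).right_inv hv
  rw [pullbackChart_apply] at h2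
  rw [← (chartAt E (s x)).left_inv h1, h2]

theorem pullbackChart_target_subset (hs : IsOpenEmbedding s) (x : X) :
    (hs.pullbackChart (E := E) x).target ⊆ (chartAt E (s x)).target := fun _ hv => hv.1

/-- The charted space structure induced by an open embedding. -/
@[reducible]
def pullbackChartedSpace (hs : IsOpenEmbedding s) : ChartedSpace E X where
  atlas := Set.range hs.pullbackChart
  chartAt := hs.pullbackChart
  mem_chart_source x := by
    rw [pullbackChart_source]
    exact mem_chart_source E (s x)
  chart_mem_atlas x := ⟨x, rfl⟩

variable [NormedSpace ℝ E]

/-- Coordinate changes are restrictions of coordinate changes of `P`. -/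
theorem isManifold_pullback [IsManifold 𝓘(ℝ, E) ∞ P] (hs : IsOpenEmbedding s) :
    letI := hs.pullbackChartedSpace (E := E)
    IsManifold 𝓘(ℝ, E) ∞ X := by
  let := hs.pullbackChartedSpace (E := E)
  refine isManifold_of_contDiffOn _ _ _ ?_
  rintro _ _ ⟨x, rfl⟩ ⟨y, rfl⟩
  have h := ModelWithCorners.contDiffOn_extendCoordChange (I := 𝓘(ℝ, E)) (n := ∞)
    (IsManifold.chart_mem_maximalAtlas (I := 𝓘(ℝ, E)) (n := ∞) (s x))
    (IsManifold.chart_mem_maximalAtlas (I := 𝓘(ℝ, E)) (n := ∞) (s y))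
  refine (h.mono ?_).congr ?_
  · rintro v ⟨hv, -⟩
    have hv : v ∈ ((hs.pullbackChart (E := E) x).symm.trans (hs.pullbackChart y)).source := hv
    rw [OpenPartialHomeomorph.trans_source, Set.mem_inter_iff, Set.mem_preimage,
      pullbackChart_source, Set.mem_preimage, OpenPartialHomeomorph.symm_source] at hv
    rw [apply_pullbackChart_symm hs x hv.1] at hv
    simpa using And.intro (hs.pullbackChart_target_subset x hv.1) hv.2
  · rintro v ⟨hv, -⟩
    exact congrArg (chartAt E (s y)) (apply_pullbackChart_symm hs x hv.1)

theorem contMDiff_pullback [IsManifold 𝓘(ℝ, E) ∞ P] (hs : IsOpenEmbedding s) :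
    letI := hs.pullbackChartedSpace (E := E)
    ContMDiff 𝓘(ℝ, E) 𝓘(ℝ, E) ∞ s := by
  let := hs.pullbackChartedSpace (E := E)
  intro x
  refine contMDiffAt_iff.2 ⟨hs.continuous.continuousAt, ?_⟩
  have h : ∀ v ∈ (hs.pullbackChart (E := E) x).target,
      chartAt E (s x) (s ((hs.pullbackChart (E := E) x).symm v)) = v := fun v hv => by
    rw [apply_pullbackChart_symm hs x hv]
    exact (chartAt E (s x)).right_inv hv.1
  have hx := (hs.pullbackChart (E := E) x).map_source (mem_chart_source E x)
  refine contDiffWithinAt_id.congr_of_eventuallyEq (Filter.Eventually.filter_mono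
    nhdsWithin_le_nhds ?_) (h _ hx)
  filter_upwards [(hs.pullbackChart (E := E) x).open_target.mem_nhds hx] with v hv using h v hv

/-- In charts, `f` and `s ∘ f` have the same expression, so only continuity of `f` has to be argued.
-/
theorem contMDiff_of_comp_pullback {E₁ : Type*} [NormedAddCommGroup E₁] [NormedSpace ℝ E₁]
    {Q : Type*} [TopologicalSpace Q] [ChartedSpace E₁ Q] (hs : IsOpenEmbedding s) {f : Q → X}
    (hf : ContMDiff 𝓘(ℝ, E₁) 𝓘(ℝ, E) ∞ (s ∘ f)) :
    letI := hs.pullbackChartedSpace (E := E)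
    ContMDiff 𝓘(ℝ, E₁) 𝓘(ℝ, E) ∞ f := by
  let := hs.pullbackChartedSpace (E := E)
  intro x
  exact contMDiffAt_iff_target.2
    ⟨(hs.isEmbedding.continuous_iff.2 hf.continuous).continuousAt, (contMDiffAt_iff_target.1 (hf x)).2⟩

end Topology.IsOpenEmbedding

end OpenEmbedding

/-! ### Global trivialisations of principal bundles -/

section Trivialisation

variable {EP EM EG : Type*} [NormedAddCommGroup EP] [NormedSpace ℝ EP]
  [NormedAddCommGroup EM] [NormedSpace ℝ EM] [NormedAddCommGroup EG] [NormedSpace ℝ EG]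
  {P M G : Type*} [TopologicalSpace P] [ChartedSpace EP P] [TopologicalSpace M]
  [ChartedSpace EM M] [Group G] [TopologicalSpace G] [ChartedSpace EG G] {q : P → M} {σ : P × G → P}

/-- An equivariant diffeomorphism `P → M × G` over `M` is given by an equivariant map `a : P → G`
together with a section `s` of `q` that satisfies `s (q p) = p * (a p)⁻¹`. -/
theorem IsSmoothRightAction.exists_equivalence (hσ : IsSmoothRightAction EP EG σ)
    (hq : ContMDiff 𝓘(ℝ, EP) 𝓘(ℝ, EM) ∞ q) (hqσ : ∀ p g, q (σ (p, g)) = q p)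
    {a : P → G} (ha : ContMDiff 𝓘(ℝ, EP) 𝓘(ℝ, EG) ∞ a) (haσ : ∀ p g, a (σ (p, g)) = a p * g)
    {s : M → P} (hs : ContMDiff 𝓘(ℝ, EM) 𝓘(ℝ, EP) ∞ s) (hqs : ∀ x, q (s x) = x)
    (hsq : ∀ p, s (q p) = σ (p, (a p)⁻¹)) :
    ∃ φ : Diffeomorph 𝓘(ℝ, EP) (𝓘(ℝ, EM).prod 𝓘(ℝ, EG)) P (M × G) ∞,
      (∀ p, (φ p).1 = q p) ∧ ∀ p g, φ (σ (p, g)) = ((φ p).1, (φ p).2 * g) := by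
  -- The section takes values in `a⁻¹(1)`, so the group component of `s(x)·g` is exactly `g`.
  have has : ∀ x, a (s x) = 1 := fun x => by
    rw [← hqs x, hsq, haσ, mul_inv_cancel]
  refine ⟨{ toFun := fun p => (q p, a p)
            invFun := fun x => σ (s x.1, x.2)
            left_inv := fun p => ?_
            right_inv := fun x => ?_
            contMDiff_toFun := hq.prodMk ha
            contMDiff_invFun := hσ.smooth.comp ((hs.comp contMDiff_fst).prodMk contMDiff_snd) },
    fun _ => rfl, fun p g => Prod.ext (hqσ p g) (haσ p g)⟩
  · simp [hsq, hσ.act_mul, hσ.act_one]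
  · simp [hqσ, hqs, haσ, has]

theorem IsSmoothRightAction.isTrivialPrincipalBundle (hσ : IsSmoothRightAction EP EG σ)
    (h : ∃ φ : Diffeomorph 𝓘(ℝ, EP) (𝓘(ℝ, EM).prod 𝓘(ℝ, EG)) P (M × G) ∞,
      (∀ p, (φ p).1 = q p) ∧ ∀ p g, φ (σ (p, g)) = ((φ p).1, (φ p).2 * g)) :
    IsTrivialPrincipalBundle EP EM EG q σ := by
  obtain ⟨φ, hφ, hφσ⟩ := h
  refine { hσ with
    free := fun p g hg => ?_
    smooth_proj := ?_
    surjective_proj := fun x => ⟨φ.symm (x, 1), by rw [← hφ, φ.apply_symm_apply]⟩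
    fibre_eq_orbit := fun p p' => ⟨fun hp => ⟨(φ p).2⁻¹ * (φ p').2, φ.injective ?_⟩, ?_⟩
    locally_trivial := fun x => ⟨⊤, ⊤, trivial, rfl, ?_⟩
    equivalence := ⟨φ, hφ, hφσ⟩ }
  · have := congrArg Prod.snd (hφσ p g)
    rw [hg] at this
    exact left_eq_mul.1 this
  · exact (contMDiff_fst.comp φ.contMDiff).congr fun p => (hφ p).symm
  · change φ _ = φ _
    rw [hφσ, hφ, hp, ← hφ p', mul_inv_cancel_left]
  · rintro ⟨g, rfl⟩
    rw [← hφ (σ (p, g)), hφσ, hφ]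
  · refine ⟨{ toFun := fun v => (⟨(φ v).1, trivial⟩, (φ v).2)
              invFun := fun y => ⟨φ.symm (y.1, y.2), trivial⟩
              left_inv := fun v => Subtype.ext (φ.symm_apply_apply _)
              right_inv := fun y => ?_
              contMDiff_toFun := ?_
              contMDiff_invFun := ?_ }, fun v => hφ v, fun v w g hw => ?_⟩
    · simp
    · have hv : ContMDiff 𝓘(ℝ, EP) (𝓘(ℝ, EM).prod 𝓘(ℝ, EG)) ∞
          fun v : (⊤ : TopologicalSpace.Opens P) => φ v := φ.contMDiff.comp contMDiff_subtype_val
      exact ((ContMDiff.subtypeVal_comp_iff _ _).1 (contMDiff_fst.comp hv)).prodMk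
        (contMDiff_snd.comp hv)
    · refine (ContMDiff.subtypeVal_comp_iff _ _).1 ?_
      exact φ.symm.contMDiff.comp
        ((contMDiff_subtype_val.comp contMDiff_fst).prodMk contMDiff_snd)
    · have : φ w = _ := hw ▸ hφσ v g
      have h1 : (φ w).1 = (φ v).1 := by rw [this]
      have h2 : (φ w).2 = (φ v).2 * g := by rw [this]
      exact Prod.ext (Subtype.ext h1) h2

/-- A section of a principal bundle of the form `q p ↦ p * (a p)⁻¹` is smooth. -/
theorem IsPrincipalBundle.contMDiff_section [LieGroup 𝓘(ℝ, EG) ∞ G]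
    (h : IsPrincipalBundle EP EM EG q σ)
    {a : P → G} (ha : ContMDiff 𝓘(ℝ, EP) 𝓘(ℝ, EG) ∞ a)
    {s : M → P} (hsq : ∀ p, s (q p) = σ (p, (a p)⁻¹)) : ContMDiff 𝓘(ℝ, EM) 𝓘(ℝ, EP) ∞ s := by
  intro x
  obtain ⟨U, V, hx, -, ψ, hψ, -⟩ := h.locally_trivial x
  refine contMDiffAt_subtype_iff.1 (?_ : ContMDiffAt _ _ _ (fun u : U => s u) ⟨x, hx⟩)
  -- A smooth local section `r` from the local trivialisation suffices: `s = r·a(r)⁻¹` on `U`.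
  let r : U → P := fun u => (ψ.symm (u, 1)).1
  have hr : ContMDiff 𝓘(ℝ, EM) 𝓘(ℝ, EP) ∞ r :=
    contMDiff_subtype_val.comp (ψ.symm.contMDiff.comp (contMDiff_id.prodMk contMDiff_const))
  have hqr : ∀ u, q (r u) = u := fun u => by
    rw [← hψ (ψ.symm (u, 1)), ψ.apply_symm_apply]
  have hs : (fun u : U => s u) = fun u => σ (r u, (a (r u))⁻¹) := funext fun u => by
    rw [← hsq, hqr]
  rw [hs]
  exact (h.smooth.comp (hr.prodMk (ha.comp hr).inv)).contMDiffAt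

end Trivialisation

/-! ### The orbit space of an action with an equivariant map to the group -/

section Orbits

theorem orbitMap_act {P G : Type*} {σ : P × G → P} (p : P) (g : G) :
    orbitMap σ (σ (p, g)) = orbitMap σ p :=
  (Quot.sound ⟨g, rfl⟩).symm

variable {P G : Type*} [Group G] {σ : P × G → P} {a : P → G}

/-- The section `[p] ↦ p * (a p)⁻¹` of the orbit map defined by an equivariant map `a`. -/
def orbitSection (hσ : ∀ p g h, σ (σ (p, g), h) = σ (p, g * h))
    (ha : ∀ p g, a (σ (p, g)) = a p * g) : OrbitSpace σ → P :=
  Quot.lift (fun p => σ (p, (a p)⁻¹)) (by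
    rintro p _ ⟨g, rfl⟩
    simp only [ha, hσ, mul_inv_rev, mul_inv_cancel_left])

theorem orbitSection_orbitMap (hσ : ∀ p g h, σ (σ (p, g), h) = σ (p, g * h))
    (ha : ∀ p g, a (σ (p, g)) = a p * g) (p : P) :
    orbitSection hσ ha (orbitMap σ p) = σ (p, (a p)⁻¹) := rfl

theorem orbitMap_orbitSection (hσ : ∀ p g h, σ (σ (p, g), h) = σ (p, g * h))
    (ha : ∀ p g, a (σ (p, g)) = a p * g) (x : OrbitSpace σ) :
    orbitMap σ (orbitSection hσ ha x) = x := by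
  obtain ⟨p, rfl⟩ := Quot.exists_rep x
  exact orbitMap_act p _

/-- The image of `U` is `pr⁻¹(U) ∩ a⁻¹(1)`, which is open because `G` is discrete. The embedding
also passes the Hausdorff property and second countability on to the orbit space. -/
theorem isOpenEmbedding_orbitSection [TopologicalSpace P] [TopologicalSpace G]
    [DiscreteTopology G] (h1 : ∀ p, σ (p, 1) = p)
    (hσ : ∀ p g h, σ (σ (p, g), h) = σ (p, g * h)) (ha : ∀ p g, a (σ (p, g)) = a p * g)
    (hcσ : Continuous σ) (hca : Continuous a) :
    Topology.IsOpenEmbedding (orbitSection hσ ha) := by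
  refine .of_continuous_injective_isOpenMap ?_ ?_ fun U hU => ?_
  · have : Continuous fun p => σ (p, (a p)⁻¹) :=
      hcσ.comp (continuous_id.prodMk (continuous_of_discreteTopology.comp hca))
    exact continuous_quot_lift _ this
  · exact Function.LeftInverse.injective (orbitMap_orbitSection hσ ha)
  · have : orbitSection hσ ha '' U = orbitMap σ ⁻¹' U ∩ a ⁻¹' {1} := by
      ext p
      constructor
      · rintro ⟨x, hx, rfl⟩
        refine ⟨by rwa [Set.mem_preimage, orbitMap_orbitSection], ?_⟩
        obtain ⟨p, rfl⟩ := Quot.exists_rep x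
        exact (ha p _).trans (mul_inv_cancel _)
      · rintro ⟨hp, hp1⟩
        refine ⟨_, hp, ?_⟩
        rw [orbitSection_orbitMap, show a p = 1 from hp1, inv_one, h1]
    rw [this]
    exact (hU.preimage continuous_quot_mk).inter ((isOpen_discrete _).preimage hca)

end Orbits

/-! ### Roots of unity -/

section Roots

theorem CyclicRoots.ext {n : ℕ} {z w : CyclicRoots n} (h : ((z : ℂˣ) : ℂ) = ((w : ℂˣ) : ℂ)) : z = w :=
  Subtype.ext (Units.ext h)

variable {n : ℕ} [NeZero n]

theorem exists_zetaGen_pow_eq (z : CyclicRoots n) : ∃ k : ℕ, zetaGen n ^ k = z := by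
  have hz : ((z : ℂˣ) : ℂ) ^ n = 1 := by
    rw [← Units.val_pow_eq_pow_val, (mem_rootsOfUnity n _).1 z.2, Units.val_one]
  obtain ⟨k, -, hk⟩ := (Complex.isPrimitiveRoot_exp n (NeZero.ne n)).eq_pow_of_pow_eq_one hz
  refine ⟨k, Subtype.ext (Units.ext ?_)⟩
  rw [← hk]
  simp [zetaGen_coe]

namespace DynamicalSystem

variable {A : Type*} [Ring A] [Algebra ℂ A] [TopologicalSpace A] [LocallyConvexAlgebra A]

/-- In a trivial noncommutative principal `C_n`-bundle, the component of the tautological character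
contains an element `a` with `a ^ n = 1`. -/
theorem IsTrivialNCPrincipalBundle.exists_equivariant {S : DynamicalSystem (CyclicRoots n) A}
    (hS : S.IsTrivialNCPrincipalBundle) :
    ∃ a : A, a ^ n = 1 ∧ ∀ z : CyclicRoots n, S.α z a = ((z : ℂˣ) : ℂ) • a := by
  -- The reduction mod `n` matters for `n = 1`, where only index 0 is available; `ζ ^ n = 1` makes
  -- it harmless.
  obtain ⟨a, ha, -, han⟩ := hS (1 % n) (Nat.mod_lt _ (NeZero.pos n))
  refine ⟨a, han, fun z => ?_⟩
  have hζ : S.α (zetaGen n) a = ((zetaGen n : ℂˣ) : ℂ) • a := by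
    rw [zetaGen_coe]
    have h1 := (Complex.isPrimitiveRoot_exp n (NeZero.ne n)).pow_eq_one
    have h2 : S.α (zetaGen n) a = _ • a := ha
    rw [h2, ← pow_eq_pow_mod 1 h1, pow_one]
  obtain ⟨k, rfl⟩ := exists_zetaGen_pow_eq z
  induction k with
  | zero => simp
  | succ k ih =>
    rw [pow_succ, map_mul, AlgEquiv.mul_apply, hζ, map_smul, ih,
      smul_smul]
    simp [mul_comm]

end DynamicalSystem

end Roots

/-! ### From dynamical systems to principal bundles -/

section ToBundle

variable {n : ℕ} [NeZero n] {E : Type*} [NormedAddCommGroup E] [NormedSpace ℝ E]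
  {P : Type*} [TopologicalSpace P] [ChartedSpace E P]

/-- A smooth function with `f ^ n = 1` is a smooth map to `C_n`. -/
def SmoothFun.toRoots (f : SmoothFun E P) (hf : f ^ n = 1) (p : P) : CyclicRoots n :=
  rootsOfUnity.mkOfPowEq (f p) (by
    have := congrArg (SmoothFun.eval E P p) hf
    rwa [map_pow, map_one] at this)

theorem SmoothFun.continuous_toRoots (f : SmoothFun E P) (hf : f ^ n = 1) :
    Continuous (f.toRoots hf) :=
  (Units.isEmbedding_val₀.comp Topology.IsEmbedding.subtypeVal).continuous_iff.2
    f.contMDiff.continuous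

variable [FiniteDimensional ℝ E] [IsManifold 𝓘(ℝ, E) ∞ P] [T2Space P]

/-- Evaluations separate points, so the action laws dualise the homomorphism property of `α`. Since
`C_n` is discrete, smoothness is checked for each `z` separately. -/
theorem isSmoothRightAction_of_eval (S : DynamicalSystem (CyclicRoots n) (SmoothFun E P))
    {σ : P × CyclicRoots n → P} (hσ : ∀ p z, SmoothFun.eval E P (σ (p, z)) =
      (SmoothFun.eval E P p).comp (S.α z : SmoothFun E P →ₐ[ℂ] SmoothFun E P)) :
    IsSmoothRightAction E (EuclideanSpace ℝ (Fin 0)) σ where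
  act_one p := SmoothFun.eval_injective (E := E) (by rw [hσ, map_one]; rfl)
  act_mul p z w := SmoothFun.eval_injective (E := E) (by rw [hσ, hσ, hσ, map_mul]; rfl)
  smooth := contMDiff_prod_discrete fun z => SmoothFun.contMDiff_of_forall_comp _ fun f =>
    (S.α z f).contMDiff.congr fun p => DFunLike.congr_fun (hσ p z) f

theorem exists_principalBundle_of_dynamicalSystem [SecondCountableTopology P]
    (S : DynamicalSystem (CyclicRoots n) (SmoothFun E P)) (hS : S.IsTrivialNCPrincipalBundle) :
    ∃ σ : P × CyclicRoots n → P,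
      (∀ p z, SmoothFun.eval E P (σ (p, z)) =
        (SmoothFun.eval E P p).comp (S.α z : SmoothFun E P →ₐ[ℂ] SmoothFun E P)) ∧
      T2Space (OrbitSpace σ) ∧ SecondCountableTopology (OrbitSpace σ) ∧
      (∃ _ : ChartedSpace E (OrbitSpace σ), IsManifold 𝓘(ℝ, E) ∞ (OrbitSpace σ) ∧
        IsPrincipalBundle E E (EuclideanSpace ℝ (Fin 0)) (orbitMap σ) σ) ∧
      (∀ _ : ChartedSpace E (OrbitSpace σ), IsManifold 𝓘(ℝ, E) ∞ (OrbitSpace σ) →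
        IsPrincipalBundle E E (EuclideanSpace ℝ (Fin 0)) (orbitMap σ) σ →
        IsTrivialPrincipalBundle E E (EuclideanSpace ℝ (Fin 0)) (orbitMap σ) σ) := by
  choose τ hτ using fun p z => SmoothFun.exists_eval_eq
    ((SmoothFun.eval E P p).comp (S.α z : SmoothFun E P →ₐ[ℂ] SmoothFun E P))
  let σ : P × CyclicRoots n → P := fun x => τ x.1 x.2
  have hσ : ∀ p z, SmoothFun.eval E P (σ (p, z)) =
    (SmoothFun.eval E P p).comp (S.α z : SmoothFun E P →ₐ[ℂ] SmoothFun E P) := hτ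
  have hact := isSmoothRightAction_of_eval S hσ
  obtain ⟨f, hfn, hf⟩ := hS.exists_equivariant
  let a := f.toRoots hfn
  have hca : Continuous a := f.continuous_toRoots hfn
  have ha : ContMDiff 𝓘(ℝ, E) 𝓘(ℝ, EuclideanSpace ℝ (Fin 0)) ∞ a := hca.contMDiff_of_discrete
  have haσ : ∀ p z, a (σ (p, z)) = a p * z := fun p z => CyclicRoots.ext (by
    have h : f (σ (p, z)) = S.α z f p := DFunLike.congr_fun (hσ p z) f
    rw [hf] at h
    exact h.trans (mul_comm _ _))
  let s := orbitSection hact.act_mul haσ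
  have hs := isOpenEmbedding_orbitSection hact.act_one hact.act_mul haσ hact.smooth.continuous hca
  have hqs := orbitMap_orbitSection hact.act_mul haσ
  have hsq := orbitSection_orbitMap hact.act_mul haσ
  refine ⟨σ, hσ, hs.isEmbedding.t2Space, hs.isEmbedding.secondCountableTopology, ?_, ?_⟩
  · let := hs.pullbackChartedSpace (E := E)
    refine ⟨this, hs.isManifold_pullback, ?_⟩
    -- Smoothness of `pr` is tested after composing with `s`, which gives `p ↦ p·a(p)⁻¹`.
    have hq : ContMDiff 𝓘(ℝ, E) 𝓘(ℝ, E) ∞ (orbitMap σ) :=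
      hs.contMDiff_of_comp_pullback (hact.smooth.comp (contMDiff_id.prodMk ha.inv))
    exact (hact.isTrivialPrincipalBundle (hact.exists_equivalence hq orbitMap_act ha haσ
      hs.contMDiff_pullback hqs hsq)).toIsPrincipalBundle
  · intro _ _ h
    exact hact.isTrivialPrincipalBundle (hact.exists_equivalence h.smooth_proj orbitMap_act ha haσ
      (h.contMDiff_section ha hsq) hqs hsq)

end ToBundle

/-! ### From principal bundles to dynamical systems -/

section ToSystem

/-- The conjugate `e⁻¹ D e` of a derivation `D` by an automorphism `e`. -/
def Derivation.conjEquiv {R A : Type*} [CommRing R] [CommRing A] [Algebra R A] (e : A ≃ₐ[R] A)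
    (D : Derivation R A A) : Derivation R A A :=
  Derivation.mk' (e.symm.toLinearMap ∘ₗ (D : A →ₗ[R] A) ∘ₗ e.toLinearMap) fun a b => by
    simp

theorem Derivation.apply_conjEquiv {R A : Type*} [CommRing R] [CommRing A] [Algebra R A]
    (e : A ≃ₐ[R] A) (D : Derivation R A A) (a : A) : e (D.conjEquiv e a) = D (e a) :=
  e.apply_symm_apply _

variable {E : Type*} [NormedAddCommGroup E] [NormedSpace ℝ E]
  {P : Type*} [TopologicalSpace P] [ChartedSpace E P]

namespace SmoothFun

/-- Each derivation passes through `e` at the price of conjugation, and the conjugate is again one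
of the derivations defining the topology. -/
theorem iterDeriv_algEquiv (e : SmoothFun E P ≃ₐ[ℂ] SmoothFun E P)
    (X : List (Derivation ℂ (SmoothFun E P) (SmoothFun E P))) (f : SmoothFun E P) :
    iterDeriv X (e f) = e (iterDeriv (X.map (Derivation.conjEquiv e)) f) := by
  induction X with
  | nil => rfl
  | cons D X ih => exact (congrArg D ih).trans (D.apply_conjEquiv e _).symm

theorem continuous_algEquiv (e : SmoothFun E P ≃ₐ[ℂ] SmoothFun E P) (τ : C(P, P))
    (he : ∀ f p, e f p = f (τ p)) : Continuous e := by
  refine (continuous_iff E P _).2 fun X => ?_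
  refine ((ContinuousMap.continuous_precomp τ).comp
    (continuous_toContinuousMap_iterDeriv E P (X.map (Derivation.conjEquiv e)))).congr fun f => ?_
  rw [iterDeriv_algEquiv]
  exact ContinuousMap.ext fun p => (he _ p).symm

/-- The pullback of smooth functions along a smooth map. -/
def pullback (τ : P → P) (hτ : ContMDiff 𝓘(ℝ, E) 𝓘(ℝ, E) ∞ τ) :
    SmoothFun E P →ₐ[ℂ] SmoothFun E P where
  toFun f := mk (fun p => f (τ p)) (f.contMDiff.comp hτ)
  map_one' := rfl
  map_mul' _ _ := rfl
  map_zero' := rfl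
  map_add' _ _ := rfl
  commutes' _ := rfl

end SmoothFun

variable {EG : Type*} [NormedAddCommGroup EG] [NormedSpace ℝ EG]
  {G : Type*} [TopologicalSpace G] [ChartedSpace EG G] [Group G] {σ : P × G → P}

namespace IsSmoothRightAction

theorem contMDiff_act (hσ : IsSmoothRightAction E EG σ) (g : G) :
    ContMDiff 𝓘(ℝ, E) 𝓘(ℝ, E) ∞ fun p => σ (p, g) :=
  hσ.smooth.comp (contMDiff_id.prodMk contMDiff_const)

/-- The automorphism `f ↦ f (σ (·, g))` of `C^∞(P)`. -/
def pullbackEquiv (hσ : IsSmoothRightAction E EG σ) (g : G) : SmoothFun E P ≃ₐ[ℂ] SmoothFun E P :=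
  AlgEquiv.ofAlgHom (SmoothFun.pullback _ (hσ.contMDiff_act g))
    (SmoothFun.pullback _ (hσ.contMDiff_act g⁻¹))
    (AlgHom.ext fun f => SmoothFun.ext fun p => congrArg f (by
      simp [hσ.act_mul, hσ.act_one]))
    (AlgHom.ext fun f => SmoothFun.ext fun p => congrArg f (by
      simp [hσ.act_mul, hσ.act_one]))

/-- The dynamical system of a smooth action of a discrete group. -/
def dynamicalSystem [FiniteDimensional ℝ E] [IsTopologicalGroup G] [DiscreteTopology G]
    (hσ : IsSmoothRightAction E EG σ) : DynamicalSystem G (SmoothFun E P) where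
  α :=
    { toFun := hσ.pullbackEquiv
      map_one' := AlgEquiv.ext fun f => SmoothFun.ext fun p => congrArg f (hσ.act_one p)
      map_mul' := fun g h => AlgEquiv.ext fun f => SmoothFun.ext fun p =>
        congrArg f (hσ.act_mul p g h).symm }
  continuous_action := continuous_prod_of_discrete_left.2 fun g =>
    SmoothFun.continuous_algEquiv (hσ.pullbackEquiv g) ⟨_, (hσ.contMDiff_act g).continuous⟩
      fun _ _ => rfl

theorem dynamicalSystem_apply [FiniteDimensional ℝ E] [IsTopologicalGroup G] [DiscreteTopology G]
    (hσ : IsSmoothRightAction E EG σ) (g : G) (f : SmoothFun E P) (p : P) :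
    hσ.dynamicalSystem.α g f p = f (σ (p, g)) := rfl

end IsSmoothRightAction

theorem IsTrivialPrincipalBundle.isTrivialNCPrincipalBundle {n : ℕ} [NeZero n]
    [FiniteDimensional ℝ E] {E' : Type*} [NormedAddCommGroup E'] [NormedSpace ℝ E']
    {M : Type*} [TopologicalSpace M] [ChartedSpace E' M] {q : P → M}
    {σ : P × CyclicRoots n → P}
    (h : IsTrivialPrincipalBundle E E' (EuclideanSpace ℝ (Fin 0)) q σ) :
    h.toIsSmoothRightAction.dynamicalSystem.IsTrivialNCPrincipalBundle := by
  obtain ⟨φ, -, hφ⟩ := h.equivalence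
  intro k _
  -- The witness is the `k`-th power of the `C_n`-component: moving `p` by `ζ` multiplies that
  -- component by `ζ`, hence its power by `ζ ^ k`.
  have hsm : ContMDiff 𝓘(ℝ, E) 𝓘(ℝ, ℂ) ∞ fun p => ((((φ p).2 ^ k : CyclicRoots n) : ℂˣ) : ℂ) :=
    (contMDiff_of_discreteTopology (I := 𝓘(ℝ, EuclideanSpace ℝ (Fin 0)))
      (f := fun z : CyclicRoots n => (((z ^ k : CyclicRoots n) : ℂˣ) : ℂ))).comp
      (contMDiff_snd.comp φ.contMDiff)
  refine ⟨SmoothFun.mk _ hsm, ?_, SmoothFun.isUnit_of_forall_ne_zero _ fun p =>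
    Units.ne_zero ((φ p).2 ^ k : CyclicRoots n).1, ?_⟩
  · refine SmoothFun.ext fun p => ?_
    rw [IsSmoothRightAction.dynamicalSystem_apply, SmoothFun.mk_apply, hφ, mul_pow, mul_comm,
      ← zetaGen_coe]
    simp
    rfl
  · refine SmoothFun.ext fun p => ?_
    have := map_pow (SmoothFun.eval E P p) (SmoothFun.mk _ hsm) n
    refine this.trans ?_
    rw [SmoothFun.eval_apply, SmoothFun.mk_apply, ← Units.val_pow_eq_pow_val,
      (mem_rootsOfUnity n _).1 (Subtype.prop _)]
    rfl

end ToSystem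

end

theorem mainTheorem6 {n : ℕ} [NeZero n]
    {E : Type*} [NormedAddCommGroup E] [NormedSpace ℝ E] [FiniteDimensional ℝ E]
    {P : Type*} [TopologicalSpace P] [ChartedSpace E P] [IsManifold 𝓘(ℝ, E) ∞ P]
    [T2Space P] [SecondCountableTopology P]
    {E' : Type*} [NormedAddCommGroup E'] [NormedSpace ℝ E'] [FiniteDimensional ℝ E']
    {M : Type*} [TopologicalSpace M] [ChartedSpace E' M] [IsManifold 𝓘(ℝ, E') ∞ M]
    [T2Space M] [SecondCountableTopology M] :
    (∀ S : DynamicalSystem (CyclicRoots n) (SmoothFun E P),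
      S.IsTrivialNCPrincipalBundle →
      ∃ σ : P × CyclicRoots n → P,
        (∀ p z, SmoothFun.eval E P (σ (p, z)) =
          (SmoothFun.eval E P p).comp (S.α z : SmoothFun E P →ₐ[ℂ] SmoothFun E P)) ∧
        T2Space (OrbitSpace σ) ∧ SecondCountableTopology (OrbitSpace σ) ∧
        (∃ _ : ChartedSpace E (OrbitSpace σ), IsManifold 𝓘(ℝ, E) ∞ (OrbitSpace σ) ∧
          IsPrincipalBundle E E (EuclideanSpace ℝ (Fin 0)) (orbitMap σ) σ) ∧
        (∀ _ : ChartedSpace E (OrbitSpace σ), IsManifold 𝓘(ℝ, E) ∞ (OrbitSpace σ) →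
          IsPrincipalBundle E E (EuclideanSpace ℝ (Fin 0)) (orbitMap σ) σ →
          IsTrivialPrincipalBundle E E (EuclideanSpace ℝ (Fin 0)) (orbitMap σ) σ)) ∧
    (∀ (q : P → M) (σ : P × CyclicRoots n → P),
      IsTrivialPrincipalBundle E E' (EuclideanSpace ℝ (Fin 0)) q σ →
      ∃ S : DynamicalSystem (CyclicRoots n) (SmoothFun E P),
        (∀ z f p, S.α z f p = f (σ (p, z))) ∧ S.IsTrivialNCPrincipalBundle) :=
  ⟨exists_principalBundle_of_dynamicalSystem, fun _ _ h =>
    ⟨h.toIsSmoothRightAction.dynamicalSystem, fun _ _ _ => rfl, h.isTrivialNCPrincipalBundle⟩⟩
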